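/- All logarithms are natural. For $\gamma>0$ let $Y_\gamma=\sqrt{\gamma}\,X+Z$ be the additive Gaussian noise channel, where $X$ is real-valued and $Z\sim\mathcal N(0,1)$ is independent of $X$. For $t\ge 0$ let $$F_I(t,\gamma)=\sup\left\{I(W;Y_\gamma)\;:\; I(W;X)\le t,\ W\to X\to Y_\gamma,\ \mathbb E[X^2]\le 1\right\},$$ where $I$ is mutual information and the supremum is over all joint distributions of $(W,X)$, with $W$ taking values in an arbitrary measurable space, such that $\mathbb E[X^2]\le 1$ and $I(W;X)\le t$, and $W\to X\to Y_\gamma$ is a Markov chain. Let $g_d(t,\gamma)=t-F_I(t,\gamma)$. Then for every fixed $\gamma>0$ there is a constant $c_3(\gamma)>0$, depending only on $\gamma$, such that for all sufficiently large real $u$ $$g_d(1/u,\gamma)\ \ge\ \frac{c_3(\gamma)}{u\sqrt{u\gamma\log u}}\,e^{-\gamma u\log u}.$$ In particular, for every fixed $\gamma>0$, as $u\to\infty$, $$g_d(1/u,\gamma)\ \ge\ e^{-\gamma u\log u+O(\log(\gamma u^{3/2}))},$$ that is, there is a function $r(u)$ with $r(u)=O(\log(\gamma u^{3/2}))$ as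 $u\to\infty$ such that $g_d(1/u,\gamma)\ge e^{-\gamma u\log u+r(u)}$ for all sufficiently large $u$. -/

import Mathlib

open MeasureTheory ProbabilityTheory InformationTheory Filter Asymptotics
open scoped ENNReal

universe u

namespace SDPI

/-- Mutual information of the two coordinates under a joint law, in nats:
the relative entropy of the joint law with respect to the product of its marginals. -/
noncomputable def mutualInfo {A B : Type*} [MeasurableSpace A] [MeasurableSpace B]
    (P : Measure (A × B)) : ℝ≥0∞ :=
  klDiv P (P.fst.prod P.snd)

/-- The law of `(W, X, Y)`, where `(W, X)` has law `P` and `W → X → Y` is a Markov chain in which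
`Y` is obtained from `X` through the channel `κ`: given `(W, X) = (w, x)`, `Y` has law `κ x`. -/
noncomputable def chainLaw {A B C : Type*} [MeasurableSpace A] [MeasurableSpace B]
    [MeasurableSpace C] (P : Measure (A × B)) (κ : Kernel B C) : Measure ((A × B) × C) :=
  P ⊗ₘ κ.prodMkLeft A

/-- The law of `(W, Y)` in the Markov chain `W → X → Y`. -/
noncomputable def endsLaw {A B C : Type*} [MeasurableSpace A] [MeasurableSpace B]
    [MeasurableSpace C] (P : Measure (A × B)) (κ : Kernel B C) : Measure (A × C) :=
  (chainLaw P κ).map (fun p => (p.1.1, p.2))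

/-- The best possible data-processing function of the channel `κ` with input laws in `Q`:
the supremum of `I(W;Y)` over all joint laws `P` of `(W, X)`, with `W` in an arbitrary measurable
space, such that `X` has law in `Q` and `I(W;X) ≤ t`. -/
noncomputable def FI {B C : Type*} [MeasurableSpace B] [MeasurableSpace C]
    (κ : Kernel B C) (Q : Set (Measure B)) (t : ℝ) : ℝ≥0∞ :=
  sSup {r : ℝ≥0∞ | ∃ (A : Type u) (_ : MeasurableSpace A) (P : Measure (A × B)),
    IsProbabilityMeasure P ∧ P.snd ∈ Q ∧ mutualInfo P ≤ ENNReal.ofReal t ∧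
      r = mutualInfo (endsLaw P κ)}

/-- The Gaussian channel `Y = √γ X + Z`, with `Z` standard normal and independent of `X`. -/
noncomputable def awgn (γ : ℝ) : Kernel ℝ ℝ :=
  (Kernel.id ×ₖ Kernel.const ℝ (gaussianReal 0 1)).map (fun p : ℝ × ℝ => √γ * p.1 + p.2)

/-- The laws on the real line with second moment at most one. -/
def secondMomentLeOne : Set (Measure ℝ) :=
  {μ | ∫⁻ x, ENNReal.ofReal (x ^ 2) ∂μ ≤ 1}

/-- The data-processing function of the Gaussian channel under the quadratic constraint
`E[X ^ 2] ≤ 1`. It is at most `t`, hence finite: see `FIGauss_le`. -/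
noncomputable def FIGauss (t γ : ℝ) : ℝ≥0∞ :=
  FI.{u} (awgn γ) secondMomentLeOne t

/-- The diagonal gap `t - F_I(t, γ)`. -/
noncomputable def gd (t γ : ℝ) : ℝ :=
  t - (FIGauss.{u} t γ).toReal

instance isMarkovKernel_awgn (γ : ℝ) : IsMarkovKernel (awgn γ) :=
  Kernel.IsMarkovKernel.map _ (by fun_prop)

theorem awgn_apply (γ x : ℝ) : awgn γ x = gaussianReal (√γ * x) 1 := by
  rw [awgn, Kernel.map_apply _ (by fun_prop), Kernel.prod_apply, Kernel.id_apply,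
    Kernel.const_apply, Measure.dirac_prod, Measure.map_map (by fun_prop) (by fun_prop)]
  have h := gaussianReal_map_const_add (μ := 0) (v := 1) (√γ * x)
  simpa [Function.comp_def] using h

theorem mutualInfo_endsLaw_le {A B C : Type*} [MeasurableSpace A] [MeasurableSpace B]
    [MeasurableSpace C] (P : Measure (A × B)) [IsProbabilityMeasure P] (κ : Kernel B C)
    [IsMarkovKernel κ] : mutualInfo (endsLaw P κ) ≤ mutualInfo P := by
  have hm : Measurable (fun p : (A × B) × C => (p.1.1, p.2)) := by fun_prop
  have h1 : (endsLaw P κ).fst = P.fst := by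
    rw [endsLaw, chainLaw, Measure.fst, Measure.map_map measurable_fst hm]
    have : Prod.fst ∘ (fun p : (A × B) × C => (p.1.1, p.2)) = Prod.fst ∘ Prod.fst := rfl
    rw [this, ← Measure.map_map measurable_fst measurable_fst]
    change Measure.map Prod.fst (Measure.fst _) = _
    rw [Measure.fst_compProd, Measure.fst]
  have h2 : (endsLaw P κ).snd = κ ∘ₘ P.snd := by
    rw [endsLaw, chainLaw, Measure.snd, Measure.map_map measurable_snd hm]
    have : Prod.snd ∘ (fun p : (A × B) × C => (p.1.1, p.2)) = Prod.snd := rfl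
    rw [this]
    change Measure.snd _ = _
    rw [Measure.snd_compProd]
    ext s hs
    rw [Measure.bind_apply hs (Kernel.aemeasurable _), Measure.bind_apply hs (Kernel.aemeasurable _),
      Measure.snd, lintegral_map (Kernel.measurable_coe κ hs) measurable_snd]
    rfl
  have h3 : endsLaw (P.fst.prod P.snd) κ = P.fst.prod (κ ∘ₘ P.snd) := by
    symm
    apply Measure.prod_eq
    intro s t hs ht
    rw [endsLaw, chainLaw, Measure.map_apply hm (hs.prod ht),
      Measure.compProd_apply (hm (hs.prod ht)), Measure.bind_apply ht (Kernel.aemeasurable _),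
      ← lintegral_indicator_one hs, ← lintegral_prod_mul
        (measurable_one.indicator hs).aemeasurable (κ.measurable_coe ht).aemeasurable]
    refine lintegral_congr fun p => ?_
    by_cases hp : p.1 ∈ s
    · simp [hp, Set.preimage]
    · simp [hp, Set.preimage]
  rw [mutualInfo, mutualInfo, h1, h2, ← h3]
  unfold endsLaw chainLaw
  refine (klDiv_map_le _ _ hm).trans ?_
  rw [klDiv_compProd_left]

theorem FIGauss_le (t γ : ℝ) : FIGauss.{u} t γ ≤ ENNReal.ofReal t := by
  refine sSup_le ?_
  rintro r ⟨A, _, P, hP, -, hle, rfl⟩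
  exact (mutualInfo_endsLaw_le P (awgn γ)).trans hle

end SDPI

/-! The gap comes from a Doeblin minorization that fails only on rare inputs. Fix a level `q` and
call an input typical when `x ^ 2 ≤ 1 / q`; by Markov's inequality the atypical ones have mass at
most `q`. With `R = √(γ / q)`, typical inputs give output means in `[-R, R]`, and all these
Gaussians dominate one common law, uniform on `[0, 1 / R]`, with weight `ε = overlap R`. Hence the
channel is a mixture: with weight `ε` a channel `β` that erases typical inputs and transmits the
others, with weight `1 - ε` some residual channel.

By convexity and data processing, `I(W;Y) ≤ (1 - ε) t + ε I(X;Y_β)`. Comparing `β` with the output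
law `(1 - q) ρ + q N(0, 1 / q)`, where `ρ` is the common law, bounds `I(X;Y_β)` by `3/2 q log (1 /
q) + O(q)`: one unit of `q log (1 / q)` for the event of being atypical, half a unit for the
Gaussian comparison (`klDiv_erasedAwgn_le`). So the gap is at least `ε (t - 3/2 q log (1 / q) -
O(q))` (`le_gd`). For `t = 1 / u` and `q = 1 / (2 u log u)` the bracket keeps a fixed fraction of
`t`, while `exp (-R ^ 2 / 2) = exp (-γ u log u)`. -/

namespace SDPI

/-! ### Relative entropy of finite measures: convexity and chain rule -/

section KL

variable {X Y : Type*} [MeasurableSpace X] [MeasurableSpace Y]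

theorem klDiv_withDensity (ν : Measure X) [IsFiniteMeasure ν] {f : X → ℝ≥0∞} (hf : Measurable f)
    [IsFiniteMeasure (ν.withDensity f)] :
    klDiv (ν.withDensity f) ν = ∫⁻ x, ENNReal.ofReal (klFun (f x).toReal) ∂ν := by
  rw [klDiv_eq_lintegral_klFun_of_ac (withDensity_absolutelyContinuous _ _)]
  refine lintegral_congr_ae ?_
  filter_upwards [Measure.rnDeriv_withDensity ν hf] with x hx
  rw [hx]

theorem klFun_mix_le {a b x y : ℝ} (ha : 0 ≤ a) (hb : 0 ≤ b) (hab : a + b = 1) (hx : 0 ≤ x)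
    (hy : 0 ≤ y) : klFun (a * x + b * y) ≤ a * klFun x + b * klFun y :=
  convexOn_klFun.2 hx hy ha hb hab

/-- Joint convexity in homogeneous form. Relative to `ν₁ + ν₂` the densities of `ν₁` and `ν₂` sum to
one, so the density of `μ₁ + μ₂` is pointwise a convex combination of the two ratios, and Jensen
applies to `klFun`. -/
theorem klDiv_add_add_le (μ₁ μ₂ ν₁ ν₂ : Measure X) [IsFiniteMeasure μ₁] [IsFiniteMeasure μ₂]
    [IsFiniteMeasure ν₁] [IsFiniteMeasure ν₂] :
    klDiv (μ₁ + μ₂) (ν₁ + ν₂) ≤ klDiv μ₁ ν₁ + klDiv μ₂ ν₂ := by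
  by_cases h₁ : μ₁ ≪ ν₁
  swap; · simp [h₁]
  by_cases h₂ : μ₂ ≪ ν₂
  swap; · simp [h₂]
  set l := ν₁ + ν₂ with hl
  have a₁ : ν₁ ≪ l := Measure.AbsolutelyContinuous.rfl.add_right _
  have a₂ : ν₂ ≪ l := by rw [hl, add_comm]; exact Measure.AbsolutelyContinuous.rfl.add_right _
  have hac : μ₁ + μ₂ ≪ l := (h₁.trans a₁).add_left (h₂.trans a₂)
  have key : ∀ (μ ν : Measure X) [IsFiniteMeasure μ] [IsFiniteMeasure ν], μ ≪ ν → ν ≪ l →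
      klDiv μ ν = ∫⁻ x, ν.rnDeriv l x * ENNReal.ofReal (klFun (μ.rnDeriv ν x).toReal) ∂l := by
    intro μ ν _ _ h h'
    rw [klDiv_eq_lintegral_klFun_of_ac h, lintegral_rnDeriv_mul h' (by fun_prop)]
  rw [klDiv_eq_lintegral_klFun_of_ac hac, key _ _ h₁ a₁, key _ _ h₂ a₂,
    ← lintegral_add_left (by fun_prop)]
  refine lintegral_mono_ae ?_
  have hsum : ν₁.rnDeriv l + ν₂.rnDeriv l =ᵐ[l] 1 := by
    filter_upwards [Measure.rnDeriv_add' ν₁ ν₂ l, Measure.rnDeriv_self l] with x hx hx'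
    rw [← hx, hx']; rfl
  filter_upwards [Measure.rnDeriv_add' μ₁ μ₂ l, hsum, Measure.rnDeriv_mul_rnDeriv (κ := l) h₁,
    Measure.rnDeriv_mul_rnDeriv (κ := l) h₂, Measure.rnDeriv_lt_top μ₁ l,
    Measure.rnDeriv_lt_top μ₂ l, Measure.rnDeriv_lt_top ν₁ l, Measure.rnDeriv_lt_top ν₂ l]
    with x h h1 e₁ e₂ t₁ t₂ s₁ s₂
  simp only [Pi.add_apply, Pi.mul_apply, Pi.one_apply] at *
  rw [h, ENNReal.toReal_add t₁.ne t₂.ne, ← e₁, ← e₂, ENNReal.toReal_mul, ENNReal.toReal_mul]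
  have hab : (ν₁.rnDeriv l x).toReal + (ν₂.rnDeriv l x).toReal = 1 := by
    rw [← ENNReal.toReal_add s₁.ne s₂.ne, h1]; rfl
  have hn := fun (μ ν : Measure X) => ENNReal.toReal_nonneg (a := μ.rnDeriv ν x)
  have := klFun_mix_le (hn ν₁ l) (hn ν₂ l) hab (hn μ₁ ν₁) (hn μ₂ ν₂)
  rw [mul_comm (ENNReal.toReal _), mul_comm ((μ₂.rnDeriv ν₂ x).toReal)]
  refine (ENNReal.ofReal_le_ofReal this).trans ?_
  rw [ENNReal.ofReal_add (mul_nonneg (hn _ _) (klFun_nonneg (hn _ _)))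
      (mul_nonneg (hn _ _) (klFun_nonneg (hn _ _))), ENNReal.ofReal_mul (hn _ _),
    ENNReal.ofReal_mul (hn _ _), ENNReal.ofReal_toReal s₁.ne, ENNReal.ofReal_toReal s₂.ne]

theorem klDiv_map_equiv (μ ν : Measure X) [IsFiniteMeasure μ] [IsFiniteMeasure ν] (e : X ≃ᵐ Y) :
    klDiv (μ.map e) (ν.map e) = klDiv μ ν := by
  refine le_antisymm (klDiv_map_le _ _ e.measurable) ?_
  have h := klDiv_map_le (μ.map e) (ν.map e) e.symm.measurable
  simpa [Measure.map_map e.symm.measurable e.measurable] using h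

/-- The relative entropy to a product law is least when the second factor is the marginal. -/
theorem mutualInfo_le_klDiv_prod [StandardBorelSpace X] [Nonempty X] (M : Measure (X × Y))
    [IsProbabilityMeasure M] (Q : Measure Y) [IsFiniteMeasure Q] :
    mutualInfo M ≤ klDiv M (M.fst.prod Q) := by
  -- Disintegrating over `Y` lets the chain rule split off `klDiv M.snd Q`; what remains is the
  -- mutual information.
  have hM : M.map Prod.swap = M.snd ⊗ₘ (M.map Prod.swap).condKernel := by
    conv_lhs => rw [← (M.map Prod.swap).disintegrate (M.map Prod.swap).condKernel]
    simp
  have key : ∀ R : Measure Y, IsFiniteMeasure R → klDiv M (M.fst.prod R) =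
      klDiv (M.snd ⊗ₘ (M.map Prod.swap).condKernel) (R ⊗ₘ Kernel.const Y M.fst) := by
    intro R _
    rw [Measure.compProd_const, ← hM, ← Measure.prod_swap (μ := M.fst) (ν := R)]
    exact (klDiv_map_equiv M (M.fst.prod R) MeasurableEquiv.prodComm).symm
  rw [mutualInfo, key _ inferInstance, key Q inferInstance, klDiv_compProd_eq_add (ν := Q)]
  exact le_add_self

/-- The term `c - 1` is the mass correction that `klDiv` carries for measures of unequal mass. -/
theorem klDiv_smul_right_self (μ : Measure X) [IsFiniteMeasure μ] {c : ℝ} (hc : 0 < c) :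
    klDiv μ (ENNReal.ofReal c • μ) = ENNReal.ofReal (-Real.log c + c - 1) * μ Set.univ := by
  have : IsFiniteMeasure (ENNReal.ofReal c • μ) := μ.smul_finite ENNReal.ofReal_ne_top
  have h : μ = (ENNReal.ofReal c • μ).withDensity (fun _ => ENNReal.ofReal c⁻¹) := by
    rw [withDensity_const, smul_smul, ← ENNReal.ofReal_mul (by positivity),
      inv_mul_cancel₀ hc.ne', ENNReal.ofReal_one, one_smul]
  have h' : IsFiniteMeasure ((ENNReal.ofReal c • μ).withDensity (fun _ => ENNReal.ofReal c⁻¹)) :=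
    h ▸ inferInstance
  conv_lhs => arg 1; rw [h]
  rw [klDiv_withDensity _ measurable_const, lintegral_const, ENNReal.toReal_ofReal (by positivity),
    Measure.smul_apply, smul_eq_mul, ← mul_assoc, ← ENNReal.ofReal_mul (klFun_nonneg (by positivity))]
  congr 2
  rw [klFun_apply, Real.log_inv]
  field_simp

theorem klDiv_kernel_eq_lintegral_klFun [MeasurableSpace.CountableOrCountablyGenerated X Y]
    (κ η : Kernel X Y) [IsFiniteKernel κ] [IsFiniteKernel η] {x : X} (h : κ x ≪ η x) :
    klDiv (κ x) (η x) = ∫⁻ y, ENNReal.ofReal (klFun (κ.rnDeriv η x y).toReal) ∂η x := by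
  rw [klDiv_eq_lintegral_klFun_of_ac h]
  refine lintegral_congr_ae ?_
  filter_upwards [Kernel.rnDeriv_eq_rnDeriv_measure (κ := κ) (η := η) (a := x)] with y hy
  rw [hy]

/-- The jointly measurable kernel density is a density of the composed measures. Keeping it in the
formula gives an integrand whose measurability in `x` is available. -/
theorem klDiv_compProd_eq_lintegral_klFun [MeasurableSpace.CountableOrCountablyGenerated X Y]
    (μ : Measure X) [IsFiniteMeasure μ] (κ η : Kernel X Y) [IsFiniteKernel κ] [IsFiniteKernel η]
    (h : ∀ᵐ x ∂μ, κ x ≪ η x) :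
    klDiv (μ ⊗ₘ κ) (μ ⊗ₘ η) =
      ∫⁻ x, ∫⁻ y, ENNReal.ofReal (klFun (κ.rnDeriv η x y).toReal) ∂η x ∂μ := by
  have hf : Measurable (Function.uncurry (κ.rnDeriv η)) := κ.measurable_rnDeriv η
  have hd : μ ⊗ₘ κ = (μ ⊗ₘ η).withDensity (Function.uncurry (κ.rnDeriv η)) := by
    ext s hs
    rw [Measure.compProd_apply hs, withDensity_apply _ hs, ← lintegral_indicator hs,
      Measure.lintegral_compProd (hf.indicator hs)]
    refine lintegral_congr_ae ?_
    filter_upwards [h] with x hx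
    rw [← Kernel.setLIntegral_rnDeriv hx (measurable_prodMk_left hs),
      ← lintegral_indicator (measurable_prodMk_left hs)]
    rfl
  have : IsFiniteMeasure ((μ ⊗ₘ η).withDensity (Function.uncurry (κ.rnDeriv η))) :=
    hd ▸ inferInstance
  rw [hd, klDiv_withDensity _ hf, Measure.lintegral_compProd (by fun_prop)]
  rfl

theorem klDiv_compProd_eq_lintegral [MeasurableSpace.CountableOrCountablyGenerated X Y]
    (μ : Measure X) [IsFiniteMeasure μ] (κ η : Kernel X Y) [IsFiniteKernel κ] [IsFiniteKernel η]
    (h : ∀ᵐ x ∂μ, κ x ≪ η x) :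
    klDiv (μ ⊗ₘ κ) (μ ⊗ₘ η) = ∫⁻ x, klDiv (κ x) (η x) ∂μ := by
  rw [klDiv_compProd_eq_lintegral_klFun μ κ η h]
  refine lintegral_congr_ae ?_
  filter_upwards [h] with x hx
  exact (klDiv_kernel_eq_lintegral_klFun κ η hx).symm

end KL
-- Mixtures of channels and data processing
section Channel

variable {A B C : Type*} [MeasurableSpace A] [MeasurableSpace B] [MeasurableSpace C]

theorem endsLaw_apply (P : Measure (A × B)) [IsFiniteMeasure P] (κ : Kernel B C) [IsFiniteKernel κ]
    {s : Set (A × C)} (hs : MeasurableSet s) :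
    endsLaw P κ s = ∫⁻ p, κ p.2 (Prod.mk p.1 ⁻¹' s) ∂P := by
  have hm : Measurable (fun p : (A × B) × C => (p.1.1, p.2)) := by fun_prop
  rw [endsLaw, chainLaw, Measure.map_apply hm hs, Measure.compProd_apply (hm hs)]
  rfl

instance isFiniteMeasure_endsLaw (P : Measure (A × B)) [IsFiniteMeasure P] (κ : Kernel B C)
    [IsFiniteKernel κ] : IsFiniteMeasure (endsLaw P κ) := by
  unfold endsLaw chainLaw; infer_instance

instance isProbabilityMeasure_endsLaw (P : Measure (A × B)) [IsProbabilityMeasure P]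
    (κ : Kernel B C) [IsMarkovKernel κ] : IsProbabilityMeasure (endsLaw P κ) := by
  have hm : Measurable (fun p : (A × B) × C => (p.1.1, p.2)) := by fun_prop
  unfold endsLaw chainLaw
  exact Measure.isProbabilityMeasure_map hm.aemeasurable

theorem fst_endsLaw (P : Measure (A × B)) [IsFiniteMeasure P] (κ : Kernel B C)
    [IsMarkovKernel κ] : (endsLaw P κ).fst = P.fst := by
  ext s hs
  rw [Measure.fst_apply hs, endsLaw_apply _ _ (measurable_fst hs), Measure.fst_apply hs,
    ← lintegral_indicator_one (measurable_fst hs)]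
  refine lintegral_congr fun p => ?_
  by_cases hp : p.1 ∈ s <;> simp [hp, Set.preimage]

theorem snd_endsLaw (P : Measure (A × B)) [IsFiniteMeasure P] (κ : Kernel B C)
    [IsFiniteKernel κ] : (endsLaw P κ).snd = κ ∘ₘ P.snd := by
  ext s hs
  rw [Measure.snd_apply hs, endsLaw_apply _ _ (measurable_snd hs),
    Measure.bind_apply hs (Kernel.aemeasurable _), Measure.snd,
    lintegral_map (Kernel.measurable_coe κ hs) measurable_snd]
  rfl

/-- Subadditivity in a mixture of channels. -/
theorem mutualInfo_endsLaw_mix_le (P : Measure (A × B)) [IsProbabilityMeasure P]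
    (κ α β : Kernel B C) [IsMarkovKernel κ] [IsMarkovKernel α] [IsMarkovKernel β] (a b : NNReal)
    (h : ∀ x, κ x = a • α x + b • β x) :
    mutualInfo (endsLaw P κ) ≤ a * mutualInfo (endsLaw P α) + b * mutualInfo (endsLaw P β) := by
  have h1 : endsLaw P κ = a • endsLaw P α + b • endsLaw P β := by
    ext s hs
    have m : ∀ η : Kernel B C, IsMarkovKernel η →
        Measurable fun p : A × B => η p.2 (Prod.mk p.1 ⁻¹' s) := fun η _ =>
      Kernel.measurable_kernel_prodMk_left (κ := η.prodMkLeft A)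
        (t := (fun p : (A × B) × C => (p.1.1, p.2)) ⁻¹' s)
        ((by fun_prop : Measurable (fun p : (A × B) × C => (p.1.1, p.2))) hs)
    simp only [Measure.add_apply, Measure.smul_apply, endsLaw_apply _ _ hs, h, ENNReal.smul_def,
      smul_eq_mul]
    rw [lintegral_add_left ((m α inferInstance).const_mul _),
      lintegral_const_mul _ (m α inferInstance), lintegral_const_mul _ (m β inferInstance)]
  -- The law of `W` does not depend on the channel, so the product of the marginals is also affine
  -- in it.
  have h2 : P.fst.prod (endsLaw P κ).snd =
      a • P.fst.prod (endsLaw P α).snd + b • P.fst.prod (endsLaw P β).snd := by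
    have : (endsLaw P κ).snd = a • (endsLaw P α).snd + b • (endsLaw P β).snd := by
      rw [h1]; ext s hs
      simp [Measure.snd_apply hs]
    rw [this, Measure.prod_add]
    simp only [ENNReal.smul_def, Measure.prod_smul_right]
  simp only [mutualInfo, fst_endsLaw]
  rw [h2, h1]
  refine (klDiv_add_add_le _ _ _ _).trans ?_
  rw [klDiv_smul_same, klDiv_smul_same]

/-- A channel that dominates a multiple `ε` of another channel has the form of a mixture. -/
theorem exists_residual_kernel (κ β : Kernel B C) [IsMarkovKernel κ] [IsMarkovKernel β]
    {ε : NNReal} (hε : ε < 1) (h : ∀ x, ε • β x ≤ κ x) :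
    ∃ α : Kernel B C, IsMarkovKernel α ∧ ∀ x, κ x = (1 - ε) • α x + ε • β x := by
  have hne : 1 - ε ≠ 0 := (tsub_pos_of_lt hε).ne'
  have ha : ∀ x s, MeasurableSet s → (κ x - ε • β x) s = κ x s - ε * β x s := fun x s hs => by
    rw [Measure.sub_apply hs (h x)]; rfl
  have hm : Measurable fun x => (1 - ε)⁻¹ • (κ x - ε • β x) := by
    refine Measure.measurable_of_measurable_coe _ fun s hs => ?_
    have : (fun x => ((1 - ε)⁻¹ • (κ x - ε • β x)) s) =
        fun x => ((1 - ε)⁻¹ : NNReal) * (κ x s - ε * β x s) := by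
      ext x; rw [← ha x s hs]; rfl
    rw [this]
    exact ((κ.measurable_coe hs).sub ((β.measurable_coe hs).const_mul _)).const_mul _
  refine ⟨⟨_, hm⟩, ⟨fun x => ⟨?_⟩⟩, fun x => ?_⟩
  · change ((1 - ε)⁻¹ • (κ x - ε • β x)) Set.univ = 1
    rw [Measure.smul_apply, ha _ _ MeasurableSet.univ]
    simp only [measure_univ, mul_one, ENNReal.smul_def, smul_eq_mul]
    rw [← ENNReal.coe_one, ← ENNReal.coe_sub, ← ENNReal.coe_mul, inv_mul_cancel₀ hne]
  · change κ x = (1 - ε) • ((1 - ε)⁻¹ • (κ x - ε • β x)) + ε • β x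
    rw [smul_smul, mul_inv_cancel₀ hne, one_smul, Measure.sub_add_cancel_of_le (h x)]

theorem mutualInfo_endsLaw_doeblin_le (P : Measure (A × B)) [IsProbabilityMeasure P]
    (κ β : Kernel B C) [IsMarkovKernel κ] [IsMarkovKernel β]
    {ε : NNReal} (hε : ε < 1) (h : ∀ x, ε • β x ≤ κ x) :
    mutualInfo (endsLaw P κ) ≤ (1 - ε : NNReal) * mutualInfo P + ε * mutualInfo (endsLaw P β) := by
  obtain ⟨α, _, hα⟩ := exists_residual_kernel κ β hε h
  refine (mutualInfo_endsLaw_mix_le P κ α β _ _ hα).trans ?_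
  gcongr
  exact mutualInfo_endsLaw_le P α

theorem map_fst_id_prod (P : Measure (A × B)) [IsProbabilityMeasure P] (σ : Measure C) [SFinite σ] :
    (P.prod σ).map (fun p : (A × B) × C => (p.1.1, p.2)) = P.fst.prod σ := by
  have := Measure.map_prod_map P σ measurable_fst measurable_id
  rw [Measure.map_id] at this
  exact this.symm

/-- Data processing at the input end. As `W` lives in an arbitrary space, no reverse channel from
`X` to `W` is used: `X` is kept beside `W`, and given both, the law of `Y` depends on `X` alone. -/
theorem mutualInfo_endsLaw_le_mutualInfo_compProd [MeasurableSpace.CountablyGenerated C]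
    (P : Measure (A × B)) [IsProbabilityMeasure P] (β : Kernel B C) [IsMarkovKernel β] :
    mutualInfo (endsLaw P β) ≤ mutualInfo (P.snd ⊗ₘ β) := by
  have hm : Measurable (fun p : (A × B) × C => (p.1.1, p.2)) := by fun_prop
  set σ := β ∘ₘ P.snd with hσ
  have h1 : mutualInfo (endsLaw P β) ≤
      klDiv (P ⊗ₘ β.prodMkLeft A) (P ⊗ₘ Kernel.const (A × B) σ) := by
    rw [mutualInfo, fst_endsLaw, snd_endsLaw, ← hσ, ← map_fst_id_prod, endsLaw,
      Measure.compProd_const]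
    have : IsFiniteMeasure (chainLaw P β) := by unfold chainLaw; infer_instance
    exact klDiv_map_le _ _ hm
  refine h1.trans ?_
  rw [mutualInfo, Measure.fst_compProd, Measure.snd_compProd, ← hσ, ← Measure.compProd_const]
  by_cases hac : P.snd ⊗ₘ β ≪ P.snd ⊗ₘ Kernel.const B σ
  swap; · rw [klDiv_of_not_ac hac]; exact le_top
  have hac' := hac.kernel_of_compProd
  have hac2 : ∀ᵐ p ∂P, β p.2 ≪ σ := ae_of_ae_map measurable_snd.aemeasurable hac'
  rw [klDiv_compProd_eq_lintegral_klFun _ _ _ hac', Measure.snd,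
    lintegral_map _ measurable_snd, klDiv_compProd_eq_lintegral _ _ _ hac2]
  · refine (lintegral_congr_ae ?_).le
    filter_upwards [hac2] with p hp
    exact klDiv_kernel_eq_lintegral_klFun β (Kernel.const B σ) hp
  · exact Measurable.lintegral_kernel_prod_right (κ := Kernel.const B σ)
      (f := fun x y => ENNReal.ofReal (klFun (β.rnDeriv (Kernel.const B σ) x y).toReal))
      ((measurable_klFun.comp (β.measurable_rnDeriv _).ennreal_toReal).ennreal_ofReal)

/-- The information that the output of a channel carries is at most the average relative entropy
of the channel to any fixed output law. -/
theorem mutualInfo_endsLaw_le_klDiv [StandardBorelSpace B] [Nonempty B]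
    [MeasurableSpace.CountablyGenerated C]
    (P : Measure (A × B)) [IsProbabilityMeasure P] (β : Kernel B C) [IsMarkovKernel β]
    (Q : Measure C) [IsFiniteMeasure Q] :
    mutualInfo (endsLaw P β) ≤ klDiv (P.snd ⊗ₘ β) (P.snd.prod Q) := by
  refine (mutualInfo_endsLaw_le_mutualInfo_compProd P β).trans ?_
  have h := mutualInfo_le_klDiv_prod (P.snd ⊗ₘ β) Q
  rwa [Measure.fst_compProd] at h

end Channel
-- Gaussian divergences and the cost of the erased channel
section Gaussian

theorem gaussianReal_eq_withDensity (m : ℝ) {s : NNReal} (hs : s ≠ 0) :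
    gaussianReal m 1 = (gaussianReal 0 s).withDensity
      (fun y => ENNReal.ofReal (Real.sqrt s * Real.exp (y ^ 2 / (2 * s) - (y - m) ^ 2 / 2))) := by
  have hs' : (0 : ℝ) < s := by positivity
  rw [gaussianReal_of_var_ne_zero _ one_ne_zero, gaussianReal_of_var_ne_zero _ hs,
    ← withDensity_mul _ (by fun_prop) (by fun_prop)]
  congr 1
  ext y
  rw [Pi.mul_apply, gaussianPDF, gaussianPDF, ← ENNReal.ofReal_mul (gaussianPDFReal_nonneg _ _ _)]
  congr 1
  rw [gaussianPDFReal, gaussianPDFReal, NNReal.coe_one, mul_one]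
  have h : Real.exp (-(y - m) ^ 2 / (2 * 1)) = Real.exp (-(y - 0) ^ 2 / (2 * s)) *
      Real.exp (y ^ 2 / (2 * s) - (y - m) ^ 2 / 2) := by
    rw [← Real.exp_add]; congr 1; ring
  have : Real.sqrt s ≠ 0 := (Real.sqrt_pos.2 hs').ne'
  rw [h, Real.sqrt_mul (show 0 ≤ 2 * Real.pi by positivity)]
  field_simp

theorem integrable_sq_gaussianReal (m : ℝ) (v : NNReal) :
    Integrable (fun y => y ^ 2) (gaussianReal m v) :=
  (memLp_id_gaussianReal 2).integrable_sq

theorem integral_sq_gaussianReal (m : ℝ) (v : NNReal) :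
    ∫ y, y ^ 2 ∂gaussianReal m v = v + m ^ 2 := by
  have h := variance_eq_sub (memLp_id_gaussianReal (μ := m) (v := v) 2)
  rw [variance_id_gaussianReal] at h
  simp only [Pi.pow_apply, id_eq, integral_id_gaussianReal] at h
  linarith

theorem klDiv_gaussianReal_le (m : ℝ) {s : NNReal} (hs : s ≠ 0) :
    klDiv (gaussianReal m 1) (gaussianReal 0 s) ≤
      ENNReal.ofReal (Real.log s / 2 + (1 + m ^ 2) / (2 * s)) := by
  have hs' : (0 : ℝ) < s := by positivity
  have hac : gaussianReal m 1 ≪ gaussianReal 0 s :=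
    (gaussianReal_absolutelyContinuous m one_ne_zero).trans
      (gaussianReal_absolutelyContinuous' 0 hs)
  have hllr : llr (gaussianReal m 1) (gaussianReal 0 s) =ᵐ[gaussianReal m 1]
      fun y => Real.log s / 2 + y ^ 2 / (2 * s) - (y - m) ^ 2 / 2 := by
    refine hac.ae_le ?_
    have h := Measure.rnDeriv_withDensity (gaussianReal 0 s)
      (f := fun y => ENNReal.ofReal
        (Real.sqrt s * Real.exp (y ^ 2 / (2 * s) - (y - m) ^ 2 / 2))) (by fun_prop)
    rw [← gaussianReal_eq_withDensity m hs] at h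
    filter_upwards [h] with y hy
    rw [llr, hy, ENNReal.toReal_ofReal (by positivity),
      Real.log_mul (Real.sqrt_pos.2 hs').ne' (Real.exp_pos _).ne', Real.log_exp,
      Real.log_sqrt hs'.le]
    ring
  have i1 := integrable_sq_gaussianReal m 1
  have i2 : Integrable (fun y => (y - m) ^ 2) (gaussianReal m 1) :=
    ((memLp_id_gaussianReal 2).sub (memLp_const m)).integrable_sq
  have i3 : Integrable (fun y => Real.log s / 2 + y ^ 2 / (2 * s)) (gaussianReal m 1) :=
    (integrable_const _).add (i1.div_const _)
  rw [klDiv_of_ac_of_integrable hac ((integrable_congr hllr).2 (i3.sub (i2.div_const _))),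
    integral_congr_ae hllr]
  refine ENNReal.ofReal_le_ofReal ?_
  rw [integral_sub i3 (i2.div_const _), integral_add (integrable_const _) (i1.div_const _),
    integral_div (μ := gaussianReal m 1) (2 * (s : ℝ)), integral_sq_gaussianReal]
  -- This term equals `1 / 2`; only its sign is needed.
  have : 0 ≤ ∫ y, (y - m) ^ 2 / 2 ∂gaussianReal m 1 := integral_nonneg fun y => by positivity
  simp only [integral_const, probReal_univ, smul_eq_mul, one_mul, NNReal.coe_one]
  linarith

/-- The inputs that are typical for a law of second moment at most one, at level `q`. -/
def typicalSet (q : ℝ) : Set ℝ := {x | x ^ 2 ≤ 1 / q}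

theorem measurableSet_typicalSet (q : ℝ) : MeasurableSet (typicalSet q) :=
  measurableSet_le (by fun_prop) measurable_const

theorem measure_typicalSet_compl_le {μ : Measure ℝ} (hμ : μ ∈ secondMomentLeOne) {q : ℝ}
    (hq : 0 < q) : μ (typicalSet q)ᶜ ≤ ENNReal.ofReal q := by
  have h := mul_meas_ge_le_lintegral (μ := μ) (f := fun x : ℝ => ENNReal.ofReal (x ^ 2))
    (by fun_prop) (ENNReal.ofReal (1 / q))
  have h2 : μ (typicalSet q)ᶜ ≤ μ {x | ENNReal.ofReal (1 / q) ≤ ENNReal.ofReal (x ^ 2)} := by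
    refine measure_mono fun x hx => ?_
    simp only [typicalSet, Set.mem_compl_iff, Set.mem_ofPred_eq, not_le] at hx
    exact ENNReal.ofReal_le_ofReal hx.le
  calc μ (typicalSet q)ᶜ
      = ENNReal.ofReal q * (ENNReal.ofReal (1 / q) * μ (typicalSet q)ᶜ) := by
        rw [← mul_assoc, ← ENNReal.ofReal_mul hq.le, mul_one_div_cancel hq.ne',
          ENNReal.ofReal_one, one_mul]
    _ ≤ ENNReal.ofReal q * 1 := by
        gcongr
        exact (mul_le_mul_right h2 _).trans (h.trans hμ)
    _ = _ := mul_one _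

open Classical in
/-- The Gaussian channel, with the output replaced by an independent one of law `ρ` whenever the
input is typical. -/
noncomputable def erasedAwgn (γ q : ℝ) (ρ : Measure ℝ) : Kernel ℝ ℝ :=
  Kernel.piecewise (measurableSet_typicalSet q) (Kernel.const ℝ ρ) (awgn γ)

theorem erasedAwgn_of_mem (γ : ℝ) {q x : ℝ} (ρ : Measure ℝ) (hx : x ∈ typicalSet q) :
    erasedAwgn γ q ρ x = ρ := by
  simp [erasedAwgn, Kernel.piecewise_apply, hx]

theorem erasedAwgn_of_notMem (γ : ℝ) {q x : ℝ} (ρ : Measure ℝ) (hx : x ∉ typicalSet q) :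
    erasedAwgn γ q ρ x = awgn γ x := by
  simp [erasedAwgn, Kernel.piecewise_apply, hx]

instance isMarkovKernel_erasedAwgn (γ q : ℝ) (ρ : Measure ℝ) [IsProbabilityMeasure ρ] :
    IsMarkovKernel (erasedAwgn γ q ρ) := by
  unfold erasedAwgn; infer_instance

/-- Variance `1 / q` balances the two costs: the logarithm is paid only on mass `q`, and the
quadratic term is at most `γ q / 2` by the second moment. -/
theorem setLIntegral_klDiv_awgn_le {γ q : ℝ} (hγ : 0 < γ) (hq : 0 < q) (hq1 : q ≤ 1)
    {μ : Measure ℝ} (hμ : μ ∈ secondMomentLeOne) :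
    ∫⁻ x in (typicalSet q)ᶜ, klDiv (awgn γ x) (gaussianReal 0 (Real.toNNReal (1 / q))) ∂μ ≤
      ENNReal.ofReal (q * Real.log (1 / q) / 2 + q + γ * q / 2) := by
  have hl : 0 ≤ Real.log (1 / q) := Real.log_nonneg (by rw [le_div_iff₀ hq]; linarith)
  have hs : Real.toNNReal (1 / q) ≠ 0 := (Real.toNNReal_pos.2 (by positivity)).ne'
  have hpt : ∀ x, klDiv (awgn γ x) (gaussianReal 0 (Real.toNNReal (1 / q))) ≤
      ENNReal.ofReal (Real.log (1 / q) / 2 + 1) +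
        ENNReal.ofReal (γ * q / 2) * ENNReal.ofReal (x ^ 2) := by
    intro x
    rw [awgn_apply, ← ENNReal.ofReal_mul (by positivity),
      ← ENNReal.ofReal_add (by positivity) (by positivity)]
    refine (klDiv_gaussianReal_le _ hs).trans (ENNReal.ofReal_le_ofReal ?_)
    rw [Real.coe_toNNReal _ (by positivity), mul_pow, Real.sq_sqrt hγ.le]
    have : (1 + γ * x ^ 2) / (2 * (1 / q)) = q / 2 + γ * q / 2 * x ^ 2 := by field_simp
    rw [this]; linarith
  calc _ ≤ ∫⁻ x in (typicalSet q)ᶜ, (ENNReal.ofReal (Real.log (1 / q) / 2 + 1) +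
        ENNReal.ofReal (γ * q / 2) * ENNReal.ofReal (x ^ 2)) ∂μ := lintegral_mono hpt
    _ = ENNReal.ofReal (Real.log (1 / q) / 2 + 1) * μ (typicalSet q)ᶜ +
        ENNReal.ofReal (γ * q / 2) * ∫⁻ x in (typicalSet q)ᶜ, ENNReal.ofReal (x ^ 2) ∂μ := by
      rw [lintegral_add_left measurable_const, setLIntegral_const,
        lintegral_const_mul _ (by fun_prop)]
    _ ≤ ENNReal.ofReal (Real.log (1 / q) / 2 + 1) * ENNReal.ofReal q +
        ENNReal.ofReal (γ * q / 2) * 1 := by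
      gcongr
      · exact measure_typicalSet_compl_le hμ hq
      · exact (setLIntegral_le_lintegral _ _).trans hμ
    _ = _ := by
      rw [mul_one, ← ENNReal.ofReal_mul (by positivity),
        ← ENNReal.ofReal_add (by positivity) (by positivity)]
      congr 1; ring

/-- The reference product splits into four pieces. Typical inputs are matched with `ρ` and atypical
ones with the wide Gaussian; the two crossed pieces have total mass at most `2 * q`. -/
theorem klDiv_erasedAwgn_le {γ q : ℝ} (hγ : 0 < γ) (hq : 0 < q) (hq1 : q ≤ 1 / 2)
    {μ : Measure ℝ} [IsProbabilityMeasure μ] (hμ : μ ∈ secondMomentLeOne)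
    (ρ : Measure ℝ) [IsProbabilityMeasure ρ] :
    klDiv (μ ⊗ₘ erasedAwgn γ q ρ) (μ.prod (ENNReal.ofReal (1 - q) • ρ +
        ENNReal.ofReal q • gaussianReal 0 (Real.toNNReal (1 / q)))) ≤
      ENNReal.ofReal (3 / 2 * (q * Real.log (1 / q)) + q * (5 + γ)) := by
  set S := typicalSet q with hS
  have mS : MeasurableSet S := measurableSet_typicalSet q
  set G := gaussianReal 0 (Real.toNNReal (1 / q)) with hG
  set a := ENNReal.ofReal (1 - q)
  set b := ENNReal.ofReal q
  have hl : 0 ≤ Real.log (1 / q) := Real.log_nonneg (by rw [le_div_iff₀ hq]; linarith)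
  have hT : μ Sᶜ ≤ b := measure_typicalSet_compl_le hμ hq
  have ha1 : a ≤ 1 := ENNReal.ofReal_le_one.2 (by linarith)
  have fin : ∀ (r : ℝ) (m : Measure ℝ) [IsFiniteMeasure m],
      IsFiniteMeasure (ENNReal.ofReal r • m) := fun r m _ => m.smul_finite ENNReal.ofReal_ne_top
  have fa := fin (1 - q) (μ.restrict S)
  have fb := fin q (μ.restrict Sᶜ)
  have fa' := fin (1 - q) (μ.restrict Sᶜ)
  have fb' := fin q (μ.restrict S)
  have hr : μ.restrict S Set.univ ≤ 1 := by
    rw [Measure.restrict_apply_univ]; exact prob_le_one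
  have e1 : μ ⊗ₘ erasedAwgn γ q ρ =
      (μ.restrict S ⊗ₘ Kernel.const ℝ ρ + μ.restrict Sᶜ ⊗ₘ awgn γ) + 0 := by
    rw [add_zero]
    conv_lhs => rw [← Measure.restrict_add_restrict_compl (μ := μ) mS]
    rw [Measure.compProd_add_left]
    congr 1
    · refine Measure.compProd_congr ?_
      filter_upwards [ae_restrict_mem mS] with x hx
      exact erasedAwgn_of_mem γ ρ hx
    · refine Measure.compProd_congr ?_
      filter_upwards [ae_restrict_mem mS.compl] with x hx
      exact erasedAwgn_of_notMem γ ρ hx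
  have e2 : μ.prod (a • ρ + b • G) =
      ((a • μ.restrict S) ⊗ₘ Kernel.const ℝ ρ + (b • μ.restrict Sᶜ) ⊗ₘ Kernel.const ℝ G) +
        ((a • μ.restrict Sᶜ).prod ρ + (b • μ.restrict S).prod G) := by
    conv_lhs => rw [← Measure.restrict_add_restrict_compl (μ := μ) mS]
    simp only [Measure.compProd_const, Measure.prod_add, Measure.add_prod, Measure.prod_smul_right,
      Measure.prod_smul_left, smul_add]
    abel
  have b1 : klDiv (μ.restrict S ⊗ₘ Kernel.const ℝ ρ) ((a • μ.restrict S) ⊗ₘ Kernel.const ℝ ρ) ≤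
      ENNReal.ofReal q := by
    rw [klDiv_compProd_left, klDiv_smul_right_self _ (by linarith)]
    refine (mul_le_of_le_one_right' hr).trans (ENNReal.ofReal_le_ofReal ?_)
    have := Real.one_sub_inv_le_log_of_pos (show 0 < 1 - q by linarith)
    have h2 : (1 - q)⁻¹ ≤ 1 + 2 * q := by
      rw [inv_le_comm₀ (by linarith) (by linarith), inv_eq_one_div, div_le_iff₀ (by linarith)]
      nlinarith
    linarith
  have b2 : klDiv (μ.restrict Sᶜ ⊗ₘ awgn γ) ((b • μ.restrict Sᶜ) ⊗ₘ Kernel.const ℝ G) ≤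
      ENNReal.ofReal (q * Real.log (1 / q)) +
        ENNReal.ofReal (q * Real.log (1 / q) / 2 + q + γ * q / 2) := by
    have hs : Real.toNNReal (1 / q) ≠ 0 := (Real.toNNReal_pos.2 (by positivity)).ne'
    rw [klDiv_compProd_eq_add, klDiv_smul_right_self _ hq, klDiv_compProd_eq_lintegral]
    · gcongr
      · rw [Measure.restrict_apply_univ, mul_comm q, ENNReal.ofReal_mul hl]
        gcongr
        rw [one_div, Real.log_inv]; linarith
      · exact setLIntegral_klDiv_awgn_le hγ hq (by linarith) hμ
    · refine ae_of_all _ fun x => ?_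
      rw [awgn_apply]
      exact (gaussianReal_absolutelyContinuous _ one_ne_zero).trans
        (gaussianReal_absolutelyContinuous' 0 hs)
  -- Against the zero measure, the crossed pieces cost exactly their mass.
  have b3 : klDiv 0 ((a • μ.restrict Sᶜ).prod ρ + (b • μ.restrict S).prod G) ≤
      ENNReal.ofReal (2 * q) := by
    rw [klDiv_zero_left, Measure.add_apply, ← Set.univ_prod_univ, Measure.prod_prod,
      Measure.prod_prod, measure_univ (μ := ρ), measure_univ (μ := G), mul_one, mul_one, Measure.smul_apply,
      Measure.smul_apply, smul_eq_mul, smul_eq_mul, Measure.restrict_apply_univ Sᶜ,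
      two_mul, ENNReal.ofReal_add hq.le hq.le]
    gcongr
    · exact (mul_le_of_le_one_left' ha1).trans hT
    · exact mul_le_of_le_one_right' hr
  rw [e1, e2]
  refine (klDiv_add_add_le _ _ _ _).trans ((add_le_add (klDiv_add_add_le _ _ _ _) le_rfl).trans ?_)
  refine (add_le_add (add_le_add b1 b2) b3).trans ?_
  rw [← ENNReal.ofReal_add (by positivity) (by positivity),
    ← ENNReal.ofReal_add (by positivity) (by positivity),
    ← ENNReal.ofReal_add (by positivity) (by positivity)]
  refine ENNReal.ofReal_le_ofReal ?_
  nlinarith [mul_pos hγ hq]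

end Gaussian
-- The minorizing law and the bound at a free level
/-- The uniform law on `[0, 1 / R]`. -/
noncomputable def uniformLaw (R : ℝ) : Measure ℝ :=
  ENNReal.ofReal R • (volume : Measure ℝ).restrict (Set.Icc 0 (1 / R))

theorem isProbabilityMeasure_uniformLaw {R : ℝ} (hR : 0 < R) :
    IsProbabilityMeasure (uniformLaw R) := by
  refine ⟨?_⟩
  rw [uniformLaw, Measure.smul_apply, Measure.restrict_apply_univ, Real.volume_Icc, sub_zero,
    smul_eq_mul, ← ENNReal.ofReal_mul hR.le, mul_one_div_cancel hR.ne', ENNReal.ofReal_one]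

/-- The mass of a uniform law on `[0, 1 / R]` that lies below every normal law of unit variance
with mean in `[-R, R]`. -/
noncomputable def overlap (R : ℝ) : ℝ :=
  (√(2 * Real.pi))⁻¹ * Real.exp (-(R + 1 / R) ^ 2 / 2) * (1 / R)

theorem overlap_pos {R : ℝ} (hR : 0 < R) : 0 < overlap R := by
  unfold overlap; positivity

theorem overlap_lt_one {R : ℝ} (hR : 1 ≤ R) : overlap R < 1 := by
  have h0 : 0 < R := by linarith
  have h1 : 1 / R ≤ 1 := by rw [div_le_one h0]; exact hR
  have h2 : Real.exp (-(R + 1 / R) ^ 2 / 2) < 1 := by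
    rw [Real.exp_lt_one_iff, neg_div]
    exact neg_neg_of_pos (by positivity)
  have h3 : (√(2 * Real.pi))⁻¹ ≤ 1 :=
    inv_le_one_of_one_le₀ (Real.one_le_sqrt.2 (by linarith [Real.pi_gt_three]))
  unfold overlap
  calc _ ≤ 1 * Real.exp (-(R + 1 / R) ^ 2 / 2) * 1 := by gcongr
    _ < 1 := by linarith

theorem overlap_smul_uniformLaw_le {R m : ℝ} (hR : 0 < R) (hm : |m| ≤ R) :
    ENNReal.ofReal (overlap R) • uniformLaw R ≤ gaussianReal m 1 := by
  set c := (√(2 * Real.pi))⁻¹ * Real.exp (-(R + 1 / R) ^ 2 / 2) with hc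
  have hc0 : 0 ≤ c := by positivity
  have h1 : ENNReal.ofReal (overlap R) • uniformLaw R =
      ((volume : Measure ℝ).restrict (Set.Icc 0 (1 / R))).withDensity
        (fun _ => ENNReal.ofReal c) := by
    rw [withDensity_const, uniformLaw, smul_smul, overlap, ← hc, ENNReal.ofReal_mul hc0, mul_assoc,
      ← ENNReal.ofReal_mul (by positivity), one_div_mul_cancel hR.ne', ENNReal.ofReal_one, mul_one]
  rw [h1, gaussianReal_of_var_ne_zero _ one_ne_zero]
  calc _ ≤ ((volume : Measure ℝ).restrict (Set.Icc 0 (1 / R))).withDensity (gaussianPDF m 1) := by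
        refine withDensity_mono ?_
        filter_upwards [ae_restrict_mem measurableSet_Icc] with y hy
        refine ENNReal.ofReal_le_ofReal ?_
        rw [gaussianPDFReal, NNReal.coe_one, mul_one, mul_one, hc]
        have : (y - m) ^ 2 ≤ (R + 1 / R) ^ 2 := by
          refine sq_le_sq.2 ?_
          rw [abs_of_pos (show 0 < R + 1 / R by positivity)]
          obtain ⟨h, h'⟩ := abs_le.1 hm
          have : 0 < 1 / R := by positivity
          exact abs_le.2 ⟨by linarith [hy.1], by linarith [hy.2]⟩
        gcongr
    _ ≤ _ := by
      rw [← restrict_withDensity measurableSet_Icc]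
      exact Measure.restrict_le_self

/-- Off the typical set the erased channel is the Gaussian channel itself, so a weight below one
suffices there. -/
theorem overlap_smul_erasedAwgn_le {γ q : ℝ} (hγ : 0 < γ) (hR : 1 ≤ √(γ / q))
    (x : ℝ) : (overlap √(γ / q)).toNNReal • erasedAwgn γ q (uniformLaw √(γ / q)) x ≤
      awgn γ x := by
  change ENNReal.ofReal (overlap √(γ / q)) • erasedAwgn γ q (uniformLaw √(γ / q)) x ≤ awgn γ x
  by_cases hx : x ∈ typicalSet q
  · rw [erasedAwgn_of_mem γ _ hx, awgn_apply]
    refine overlap_smul_uniformLaw_le (by linarith) (Real.abs_le_sqrt ?_)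
    rw [mul_pow, Real.sq_sqrt hγ.le, div_eq_mul_one_div]
    exact mul_le_mul_of_nonneg_left hx hγ.le
  · rw [erasedAwgn_of_notMem γ _ hx]
    refine Measure.le_intro fun s _ _ => ?_
    exact mul_le_of_le_one_left' (ENNReal.ofReal_le_one.2 (overlap_lt_one hR).le)

theorem FIGauss_le_overlap {γ q t : ℝ} (hγ : 0 < γ) (hq : 0 < q) (hq1 : q ≤ 1 / 2)
    (hR : 1 ≤ √(γ / q)) (ht : 0 ≤ t) :
    FIGauss.{u} t γ ≤ ENNReal.ofReal ((1 - overlap √(γ / q)) * t +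
      overlap √(γ / q) * (3 / 2 * (q * Real.log (1 / q)) + q * (5 + γ))) := by
  have hl : 0 ≤ Real.log (1 / q) := Real.log_nonneg (by rw [le_div_iff₀ hq]; linarith)
  set R := √(γ / q) with hRdef
  have hε := overlap_pos (show 0 < R by linarith)
  have hε1 := overlap_lt_one hR
  have := isProbabilityMeasure_uniformLaw (show 0 < R by linarith)
  refine sSup_le ?_
  rintro r ⟨A, _, P, hP, hQ, hle, rfl⟩
  have : IsProbabilityMeasure P.snd := inferInstance
  have h1 := mutualInfo_endsLaw_doeblin_le P (awgn γ) (erasedAwgn γ q (uniformLaw R))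
    (ε := (overlap R).toNNReal) (Real.toNNReal_lt_one.2 hε1)
    (overlap_smul_erasedAwgn_le hγ hR)
  have fin : ∀ (r : ℝ) (m : Measure ℝ) [IsFiniteMeasure m],
      IsFiniteMeasure (ENNReal.ofReal r • m) := fun r m _ => m.smul_finite ENNReal.ofReal_ne_top
  have f1 := fin (1 - q) (uniformLaw R)
  have f2 := fin q (gaussianReal 0 (Real.toNNReal (1 / q)))
  have h2 := (mutualInfo_endsLaw_le_klDiv P (erasedAwgn γ q (uniformLaw R)) _).trans
    (klDiv_erasedAwgn_le hγ hq hq1 hQ (uniformLaw R))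
  refine h1.trans ((add_le_add (mul_le_mul_right hle _) (mul_le_mul_right h2 _)).trans ?_)
  have e1 : ((1 - (overlap R).toNNReal : NNReal) : ℝ≥0∞) = ENNReal.ofReal (1 - overlap R) := by
    rw [ENNReal.ofReal_sub _ hε.le, ENNReal.ofReal_one, ENNReal.coe_sub, ENNReal.coe_one,
      ENNReal.ofReal]
  rw [e1, ← ENNReal.ofReal_mul (by linarith)]
  change _ + ENNReal.ofReal (overlap R) * _ ≤ _
  rw [← ENNReal.ofReal_mul hε.le, ← ENNReal.ofReal_add
    (mul_nonneg (by linarith) ht) (by positivity)]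

/-- A lower bound on the diagonal gap with a free truncation level `q`. -/
theorem le_gd {γ q t : ℝ} (hγ : 0 < γ) (hq : 0 < q) (hq1 : q ≤ 1 / 2)
    (hR : 1 ≤ √(γ / q)) (ht : 0 ≤ t) :
    overlap √(γ / q) * (t - (3 / 2 * (q * Real.log (1 / q)) + q * (5 + γ))) ≤ gd.{u} t γ := by
  have hl : 0 ≤ Real.log (1 / q) := Real.log_nonneg (by rw [le_div_iff₀ hq]; linarith)
  have hε := overlap_pos (show 0 < √(γ / q) by linarith)
  have hε1 := overlap_lt_one hR
  have h := ENNReal.toReal_le_of_le_ofReal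
    (add_nonneg (mul_nonneg (by linarith) ht) (by positivity)) (FIGauss_le_overlap.{u} hγ hq hq1 hR ht)
  unfold gd
  linarith

/-! ### Choice of the level and asymptotics -/

theorem overlap_ge {R : ℝ} (hR : 1 ≤ R) :
    (√(2 * Real.pi))⁻¹ * Real.exp (-(3 / 2)) * Real.exp (-(R ^ 2 / 2)) * (1 / R) ≤ overlap R := by
  have h0 : 0 < R := by linarith
  have h1 : 1 / R ≤ 1 := by rw [div_le_one h0]; exact hR
  have h2 : 0 < 1 / R := by positivity
  have h3 : R * (1 / R) = 1 := mul_one_div_cancel h0.ne'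
  unfold overlap
  rw [mul_assoc (√(2 * Real.pi))⁻¹ (Real.exp (-(3 / 2))), ← Real.exp_add]
  gcongr
  -- `(R + 1 / R) ^ 2 ≤ R ^ 2 + 3`: with an interval of length `1 / R` the cross term is constant,
  -- so only the factor `exp (-(3 / 2))` is lost.
  nlinarith

/-- Here `log (1 / q) = log 2 + log v + log (log v)`, so the main term is `3 / 4 * (1 / v)`; the
slack up to `7 / 8` absorbs the rest. -/
theorem eventually_level_le (γ : ℝ) : ∀ᶠ v : ℝ in atTop,
    3 / 2 * (1 / (2 * v * Real.log v) * Real.log (1 / (1 / (2 * v * Real.log v)))) +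
      1 / (2 * v * Real.log v) * (5 + γ) ≤ 7 / 8 * (1 / v) := by
  have h1 : ∀ᶠ L : ℝ in atTop, Real.log L ≤ 1 / 24 * L := by
    filter_upwards [Real.isLittleO_log_id_atTop.bound (show (0 : ℝ) < 1 / 24 by norm_num),
      eventually_ge_atTop 0] with L hL h0
    rw [id, Real.norm_of_nonneg h0] at hL
    exact (Real.le_norm_self _).trans hL
  filter_upwards [Real.tendsto_log_atTop.eventually h1,
    Real.tendsto_log_atTop.eventually_ge_atTop (24 * (Real.log 2 + |5 + γ|) + 1),
    eventually_gt_atTop 1] with v hv hL hv1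
  have hl2 := Real.log_pos one_lt_two
  have hγ := abs_nonneg (5 + γ)
  have hγ' := le_abs_self (5 + γ)
  have hLpos : 0 < Real.log v := Real.log_pos hv1
  have hv0 : 0 < v := by linarith
  rw [one_div_one_div, Real.log_mul (by positivity) hLpos.ne', Real.log_mul two_ne_zero hv0.ne']
  set L := Real.log v
  rw [show 3 / 2 * (1 / (2 * v * L) * (Real.log 2 + L + Real.log L)) + 1 / (2 * v * L) * (5 + γ) =
    (3 / 4 * (Real.log 2 + L + Real.log L) + (5 + γ) / 2) / (v * L) by field_simp; ring,
    show 7 / 8 * (1 / v) = (7 / 8 * L) / (v * L) by field_simp]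
  gcongr
  linarith

theorem eventually_le_gd {γ : ℝ} (hγ : 0 < γ) : ∀ᶠ v : ℝ in atTop,
    ((√(2 * Real.pi))⁻¹ * Real.exp (-(3 / 2)) * (√2)⁻¹ / 8) / (v * √(v * γ * Real.log v)) *
      Real.exp (-(γ * v * Real.log v)) ≤ gd.{u} (1 / v) γ := by
  have hlin : Tendsto (fun v : ℝ => γ * v) atTop atTop := tendsto_id.const_mul_atTop hγ
  filter_upwards [eventually_level_le γ, Real.tendsto_log_atTop.eventually_ge_atTop 1,
    eventually_ge_atTop 1, hlin.eventually_ge_atTop 1] with v h1 hL hv hγv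
  have hv0 : 0 < v := by linarith
  have hL0 : 0 < Real.log v := by linarith
  set L := Real.log v
  -- The factor 2 makes `R ^ 2 / 2` equal to `γ * v * L`, the exact exponent, and still leaves a
  -- cost below `1 / v`.
  set q := 1 / (2 * v * L) with hq
  have hq0 : 0 < q := by positivity
  have hvL : 1 ≤ v * L := one_le_mul_of_one_le_of_one_le hv hL
  have hq1 : q ≤ 1 / 2 := by
    rw [hq]; exact one_div_le_one_div_of_le two_pos (by linarith)
  have hγq : γ / q = 2 * (v * γ * L) := by rw [hq]; field_simp
  have hbig : 1 ≤ v * γ * L := by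
    rw [mul_comm v]; exact one_le_mul_of_one_le_of_one_le hγv hL
  have hR : 1 ≤ √(γ / q) := Real.one_le_sqrt.2 (by rw [hγq]; linarith)
  refine le_trans ?_ (le_gd.{u} hγ hq0 hq1 hR (by positivity : 0 ≤ 1 / v))
  have h2 : 1 / v * (1 / 8) ≤ 1 / v - (3 / 2 * (q * Real.log (1 / q)) + q * (5 + γ)) := by
    linarith
  refine le_trans (le_of_eq ?_) (mul_le_mul (overlap_ge hR) h2 (by positivity)
    (overlap_pos (by linarith)).le)
  rw [Real.sq_sqrt (by positivity), hγq, Real.sqrt_mul (two_pos.le : (0 : ℝ) ≤ 2) (v * γ * L),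
    show 2 * (v * γ * L) / 2 = γ * v * L by ring]
  have : √(v * γ * L) ≠ 0 := (Real.sqrt_pos.2 (by linarith)).ne'
  field_simp

end SDPI

theorem mainTheorem2 (γ : ℝ) (hγ : 0 < γ) :
    (∃ c₃ : ℝ, 0 < c₃ ∧ ∀ᶠ u : ℝ in atTop,
      c₃ / (u * √(u * γ * Real.log u)) * Real.exp (-(γ * u * Real.log u))
        ≤ SDPI.gd.{u} (1 / u) γ) ∧
    (∃ r : ℝ → ℝ, r =O[atTop] (fun u : ℝ => Real.log (γ * u ^ (3 / 2 : ℝ))) ∧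
      ∀ᶠ u : ℝ in atTop,
        Real.exp (-(γ * u * Real.log u) + r u) ≤ SDPI.gd.{u} (1 / u) γ) := by
  have main := SDPI.eventually_le_gd.{u} hγ
  set c := (√(2 * Real.pi))⁻¹ * Real.exp (-(3 / 2)) * (√2)⁻¹ / 8 with hc
  have hc0 : 0 < c := by positivity
  refine ⟨⟨c, hc0, main⟩, fun v => Real.log (c / (v * √(v * γ * Real.log v))), ?_, ?_⟩
  -- The logarithm of the prefactor is `log c - 3/2 log v - 1/2 log γ - 1/2 log (log v)`; once `log
  -- v` dominates the constants, 4 is ample.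
  · refine IsBigO.of_bound 4 ?_
    filter_upwards [Real.tendsto_log_atTop.eventually_ge_atTop
      (1 + |Real.log c| + 2 * |Real.log γ|), eventually_gt_atTop 1] with v hL hv
    have hv0 : 0 < v := by linarith
    have a1 := abs_nonneg (Real.log c)
    have a2 := abs_nonneg (Real.log γ)
    have hL0 : 0 < Real.log v := by linarith
    have hLL : Real.log (Real.log v) ≤ Real.log v := (Real.log_le_self hL0.le)
    have hLL0 : 0 ≤ Real.log (Real.log v) := Real.log_nonneg (by linarith)
    have hpos : 0 < v * γ * Real.log v := by positivity
    rw [Real.log_div hc0.ne' (mul_pos hv0 (Real.sqrt_pos.2 hpos)).ne',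
      Real.log_mul hv0.ne' (Real.sqrt_pos.2 hpos).ne', Real.log_sqrt hpos.le,
      Real.log_mul (by positivity) hL0.ne', Real.log_mul hv0.ne' hγ.ne',
      Real.log_mul hγ.ne' (by positivity), Real.log_rpow hv0, Real.norm_eq_abs, Real.norm_eq_abs]
    obtain ⟨b1, b2⟩ := abs_le.1 (le_refl |Real.log c|)
    obtain ⟨b3, b4⟩ := abs_le.1 (le_refl |Real.log γ|)
    have h1 := le_abs_self (Real.log γ + 3 / 2 * Real.log v)
    exact abs_le.2 ⟨by linarith, by linarith⟩
  · filter_upwards [main, Real.tendsto_log_atTop.eventually_gt_atTop 0, eventually_gt_atTop 0]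
      with v h hL hv
    have : 0 < v * γ * Real.log v := by positivity
    rw [Real.exp_add, Real.exp_log (by positivity), mul_comm]
    exact h
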